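/- A continuum is a connected compact metrizable space with more than one point; a subcontinuum of a continuum $Y$ is a non-empty compact connected subset of $Y$ (one-point sets are allowed). The meager composant of a point $x\in Y$ is the union of all nowhere dense subcontinua of $Y$ that contain $x$. A connected space $Z$ is *indecomposable* if it is not the union of two proper closed connected subsets. It is *strongly indecomposable* if for every two non-empty disjoint open sets $U,V\subseteq Z$ there are disjoint closed sets $A,B\subseteq Z$ with $Z\setminus U=A\cup B$, $A\cap V\neq\emptyset$ and $B\cap V\neq\emptyset$. It is *irreducible* if there are points $p,q\in Z$ such that no proper closed connected subset of $Z$ contains both $p$ and $q$. A connected subset $X$ of $Y$ is *singular with respect to* $y\in Y$ if every connected set $C\subseteq X$ whose closure in $Y$ contains $y$ is dense in $X$. Let $Y$ be a continuum and let $X$ be a meager composant of $Y$ (that is, the meager composant of some point of $Y$) that is dense in $Y$. Then the following are equivalent (subsets of $Y$ carry the subspace topology): 1. $X$ is indecomposable; 2. $X$ is strongly indecomposable; 3. there exists $y\in Y$ such that $X$ is singular with respect to $y$; 4. $Y\setminus X\neq\emptyset$ and $X$ is singular with respect to each point of $Y\setminus X$; 5. there exists $y\in Y$ such that the connected set $X\cup\{y\}$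 is irreducible; 6. $Y\setminus X\neq\emptyset$ and $X\cup\{y\}$ is irreducible for every $y\in Y\setminus X$; 7. $X\cup\{y\}$ is indecomposable for every $y\in Y$. -/

import Mathlib

namespace ContinuumTheory

/-- A connected space is indecomposable if it is not the union of two proper closed connected
subsets. -/
def IsIndecomposable (Z : Type*) [TopologicalSpace Z] : Prop :=
  ConnectedSpace Z ∧
    ¬ ∃ H K : Set Z, IsClosed H ∧ IsConnected H ∧ H ≠ Set.univ ∧
      IsClosed K ∧ IsConnected K ∧ K ≠ Set.univ ∧ H ∪ K = Set.univ

/-- A connected space is strongly indecomposable if for any two non-empty disjoint open sets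
`U` and `V`, the complement of `U` is the union of two disjoint closed sets that both meet `V`. -/
def IsStronglyIndecomposable (Z : Type*) [TopologicalSpace Z] : Prop :=
  ConnectedSpace Z ∧
    ∀ U V : Set Z, IsOpen U → IsOpen V → U.Nonempty → V.Nonempty → Disjoint U V →
      ∃ A B : Set Z, IsClosed A ∧ IsClosed B ∧ Disjoint A B ∧ Uᶜ = A ∪ B ∧
        (A ∩ V).Nonempty ∧ (B ∩ V).Nonempty

/-- A connected space is irreducible if there are two points `p` and `q` such that no proper closed
connected subset contains both. This is unrelated to the notion of algebraic geometry. -/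
def IsIrreducibleConnected (Z : Type*) [TopologicalSpace Z] : Prop :=
  ConnectedSpace Z ∧
    ∃ p q : Z, ∀ C : Set Z, IsClosed C → IsConnected C → p ∈ C → q ∈ C → C = Set.univ

/-- Subcontinua are the non-empty compact connected subsets; one-point sets are allowed. -/
def IsSubcontinuum {Y : Type*} [TopologicalSpace Y] (K : Set Y) : Prop :=
  IsCompact K ∧ IsConnected K

/-- The meager composant of `x`: the union of all nowhere dense subcontinua that contain `x`. -/
def meagerComposant {Y : Type*} [TopologicalSpace Y] (x : Y) : Set Y :=
  ⋃₀ {K : Set Y | IsSubcontinuum K ∧ IsNowhereDense K ∧ x ∈ K}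

/-- A connected subset `X` of `Y` is singular with respect to `y : Y` if every connected `C ⊆ X`
whose closure in `Y` contains `y` is dense in `X`. Here `closure` is the closure in `Y`, and
`closure C ∩ X` is the closure of `C` in the subspace `X`. -/
def IsSingularWrt {Y : Type*} [TopologicalSpace Y] (X : Set Y) (y : Y) : Prop :=
  IsConnected X ∧
    ∀ C : Set Y, C ⊆ X → IsConnected C → y ∈ closure C → closure C ∩ X = X

end ContinuumTheory

namespace ContinuumTheory

open Set Topology

/-! ### Disjoint clopen covers in second countable spaces. -/

section ClopenCovers

variable {S : Type*} [TopologicalSpace S] [SecondCountableTopology S]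

/-! Two properties of `X` carry everything. It absorbs nowhere dense continua
(`AbsorbsNowhereDense`), and any two of its points lie in a nowhere dense continuum inside `X`.
Indecomposability is used through one fact: a connected subset of `X` whose closure has interior is
dense in `X`.

The deep ingredient is `isPreconnected_quasiComponent`: absorption forces the quasi-components of
relatively closed subsets `S` of `X` to be connected, although `S` need not be compact. Each
quasi-component is the trace on `S` of a continuum in `Y`, its `quasiHull`. Hulls of other
quasi-components that accumulate at a point `r` have a limit continuum which is nowhere dense, hence
inside `X`, hence inside `S`. This control near `r` turns a separation of the quasi-component of `r`
into a clopen subset of `S` that cuts it, which is impossible.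

Strong indecomposability and irreducibility of `X ∪ {y}` follow: a quasi-component of a proper
relatively closed set is connected, so it is not dense in any open set. Singularity needs only
absorption, and `Xᶜ` is non-empty by Baire. The converses combine density of `X` with nowhere dense
continua that join points. -/

theorem exists_seq_disjoint_isClopen_cover {P : Set S → Prop} (hempty : P ∅)
    (hmono : ∀ G H : Set S, H ⊆ G → P G → P H) {T : Set S}
    (hT : ∀ s ∈ T, ∃ G, IsClopen G ∧ s ∈ G ∧ P G) :
    ∃ E : ℕ → Set S, (∀ n, IsClopen (E n)) ∧ (∀ n, P (E n)) ∧
      Pairwise (Function.onFun Disjoint E) ∧ T ⊆ ⋃ n, E n := by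
  obtain ⟨𝒢, h𝒢, hcount, hcov⟩ : ∃ 𝒢 : Set (Set S), (∀ G ∈ 𝒢, IsClopen G ∧ P G) ∧
      𝒢.Countable ∧ T ⊆ ⋃₀ 𝒢 := by
    choose! G hGc hG hGP using hT
    obtain ⟨t, htT, htc, ht⟩ := TopologicalSpace.countable_cover_nhdsWithin
      (s := T) (f := G) fun x hx => mem_nhdsWithin_of_mem_nhds ((hGc x hx).isOpen.mem_nhds (hG x hx))
    refine ⟨G '' t, ?_, htc.image G, ?_⟩
    · rintro _ ⟨s, hs, rfl⟩
      exact ⟨hGc s (htT hs), hGP s (htT hs)⟩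
    · simpa [sUnion_image] using ht
  obtain ⟨f, hf⟩ : ∃ f : ℕ → Set S, insert ∅ 𝒢 = range f :=
    (hcount.insert ∅).exists_eq_range (insert_nonempty _ _)
  have hfP : ∀ n, IsClopen (f n) ∧ P (f n) := fun n => by
    have : f n ∈ insert ∅ 𝒢 := hf ▸ mem_range_self n
    rcases this with h | h
    · rw [h]; exact ⟨isClopen_empty, hempty⟩
    · exact h𝒢 _ h
  refine ⟨disjointed f, fun n => ?_, fun n => hmono _ _ (disjointed_subset f n) (hfP n).2,
    disjoint_disjointed f, ?_⟩
  · exact disjointedRec (fun t i ht => ht.diff (hfP i).1) (hfP n).1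
  · rw [iUnion_disjointed]
    intro x hx
    obtain ⟨G, hG, hxG⟩ := hcov hx
    have : G ∈ range f := hf ▸ mem_insert_of_mem _ hG
    obtain ⟨n, rfl⟩ := this
    exact mem_iUnion.2 ⟨n, hxG⟩

/-- Infinite unions of clopen sets need not be closed. For a disjoint clopen cover of `E`, however,
the complement in `E` of a union of pieces is covered by the remaining pieces, so it is open too. -/
theorem exists_isClopen_split {E a b : Set S} (hE : IsClopen E)
    (h : ∀ s ∈ E, ∃ G, IsClopen G ∧ s ∈ G ∧ (G ⊆ a ∨ G ⊆ b)) :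
    ∃ F ⊆ E, IsClopen F ∧ F ⊆ a ∧ E \ F ⊆ b := by
  obtain ⟨D, hDc, hDP, hDd, hDT⟩ := exists_seq_disjoint_isClopen_cover
    (P := fun G => G ⊆ a ∨ G ⊆ b) (Or.inl (empty_subset _))
    (fun G H hHG => Or.imp hHG.trans hHG.trans) h
  have hopen : ∀ p : ℕ → Prop, IsOpen (E ∩ ⋃ (n) (_ : p n), D n) := fun p =>
    hE.isOpen.inter (isOpen_iUnion fun n => isOpen_iUnion fun _ => (hDc n).isOpen)
  have hcompl : (E ∩ ⋃ (n) (_ : D n ⊆ a), D n)ᶜ = Eᶜ ∪ E ∩ ⋃ (n) (_ : ¬ D n ⊆ a), D n := by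
    ext x
    by_cases hx : x ∈ E
    · obtain ⟨m, hm⟩ := mem_iUnion.1 (hDT hx)
      have huniq : ∀ n, x ∈ D n → n = m := fun n hn => by
        by_contra hne
        exact disjoint_left.1 (hDd hne) hn hm
      simp only [mem_compl_iff, mem_inter_iff, hx, mem_iUnion, exists_prop, true_and, mem_union,
        not_true_eq_false, false_or]
      constructor
      · intro h'
        exact ⟨m, fun hs => h' ⟨m, hs, hm⟩, hm⟩
      · rintro ⟨n, hn, hxn⟩ ⟨k, hk, hxk⟩
        rw [huniq n hxn] at hn
        rw [huniq k hxk] at hk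
        exact hn hk
    · simp [hx]
  refine ⟨E ∩ ⋃ (n) (_ : D n ⊆ a), D n, inter_subset_left, ⟨?_, hopen _⟩, ?_, ?_⟩
  · rw [← isOpen_compl_iff, hcompl]
    exact hE.compl.isOpen.union (hopen _)
  · rintro x ⟨-, hx⟩
    simp only [mem_iUnion, exists_prop] at hx
    obtain ⟨n, hn, hxn⟩ := hx
    exact hn hxn
  · rintro x ⟨hxE, hx⟩
    obtain ⟨m, hm⟩ := mem_iUnion.1 (hDT hxE)
    refine (hDP m).resolve_left (fun hs => hx ⟨hxE, ?_⟩) hm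
    simp only [mem_iUnion, exists_prop]
    exact ⟨m, hs, hm⟩

end ClopenCovers

/-- A directed intersection of closed sets in a compact normal space is connected as soon as every
member of the family that is covered by two disjoint open sets can be refined into the closure of
the one that contains a given point of the intersection. -/
theorem isConnected_iInter_of_directed {Y ι : Type*} [TopologicalSpace Y] [CompactSpace Y]
    [NormalSpace Y] [Nonempty ι] {V : ι → Set Y} (hV : Directed (· ⊇ ·) V)
    (hclosed : ∀ i, IsClosed (V i)) {r : Y} (hr : r ∈ ⋂ i, V i)
    (h : ∀ O₁ O₂ : Set Y, IsOpen O₁ → IsOpen O₂ → Disjoint O₁ O₂ → r ∈ O₁ →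
      ∀ i, V i ⊆ O₁ ∪ O₂ → ∃ j, V j ⊆ closure O₁) :
    IsConnected (⋂ i, V i) := by
  refine ⟨⟨r, hr⟩, ?_⟩
  have hL : IsClosed (⋂ i, V i) := isClosed_iInter hclosed
  have key : ∀ u v : Set Y, IsClosed u → IsClosed v → (⋂ i, V i) ⊆ u ∪ v →
      (⋂ i, V i) ∩ (u ∩ v) = ∅ → r ∈ u → (⋂ i, V i) ⊆ u := by
    intro u v hu hv huv hd hru
    have hdisj : Disjoint ((⋂ i, V i) ∩ u) ((⋂ i, V i) ∩ v) := by
      rw [disjoint_left]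
      rintro x ⟨hx, hxu⟩ ⟨-, hxv⟩
      exact (hd ▸ (⟨hx, hxu, hxv⟩ : x ∈ (⋂ i, V i) ∩ (u ∩ v)) : x ∈ (∅ : Set Y))
    obtain ⟨O₁, O₂, h₁, h₂, hs₁, hs₂, hO⟩ := normal_separation (hL.inter hu) (hL.inter hv) hdisj
    obtain ⟨i, hi⟩ := exists_subset_nhds_of_compactSpace hV hclosed (U := O₁ ∪ O₂) fun x hx =>
      (h₁.union h₂).mem_nhds <| (huv hx).imp (fun hxu => hs₁ ⟨hx, hxu⟩) fun hxv => hs₂ ⟨hx, hxv⟩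
    obtain ⟨j, hj⟩ := h O₁ O₂ h₁ h₂ hO (hs₁ ⟨hr, hru⟩) i hi
    intro x hx
    refine (huv hx).resolve_right fun hxv => ?_
    exact disjoint_left.1 (hO.closure_left h₂) (hj (mem_iInter.1 hx j)) (hs₂ ⟨hx, hxv⟩)
  rw [isPreconnected_iff_subset_of_disjoint_closed]
  intro u v hu hv huv hd
  rcases huv hr with hru | hrv
  · exact Or.inl (key u v hu hv huv hd hru)
  · exact Or.inr (key v u hv hu (by rwa [union_comm]) (by rwa [inter_comm v u]) hrv)

/-! ### Quasi-components and their hulls in the compact space. -/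

section QuasiComponents

/-- The quasi-component of a point: the intersection of all clopen sets that contain it. -/
def quasiComponent {S : Type*} [TopologicalSpace S] (s : S) : Set S :=
  {t | ∀ G : Set S, IsClopen G → s ∈ G → t ∈ G}

theorem mem_quasiComponent_self {S : Type*} [TopologicalSpace S] (s : S) : s ∈ quasiComponent s :=
  fun _ _ h => h

theorem isClosed_quasiComponent {S : Type*} [TopologicalSpace S] (s : S) :
    IsClosed (quasiComponent s) := by
  have : quasiComponent s = ⋂ (G : Set S) (_ : IsClopen G) (_ : s ∈ G), G := by
    ext t; simp [quasiComponent]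
  rw [this]
  exact isClosed_iInter fun G => isClosed_iInter fun hG => isClosed_iInter fun _ => hG.isClosed

theorem exists_isClopen_disjoint_quasiComponent {S : Type*} [TopologicalSpace S] {s t : S}
    (ht : t ∉ quasiComponent s) : ∃ G, IsClopen G ∧ t ∈ G ∧ Disjoint G (quasiComponent s) := by
  simp only [quasiComponent, mem_ofPred_eq, not_forall] at ht
  obtain ⟨G, hG, hs, htG⟩ := ht
  exact ⟨Gᶜ, hG.compl, htG, disjoint_left.2 fun x hx hxs => hx (hxs G hG hs)⟩

theorem IsPreconnected.subset_quasiComponent {S : Type*} [TopologicalSpace S] {s : S} {C : Set S}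
    (hC : IsPreconnected C) (hs : s ∈ C) : C ⊆ quasiComponent s := fun _ ht _ hG hsG =>
  hC.subset_isClopen hG ⟨s, hs, hsG⟩ ht

variable {Y : Type*} [TopologicalSpace Y]

/-- The intersection of the closures in `Y` of all clopen subsets of `S` that contain `s`. -/
def quasiHull (S : Set Y) (s : S) : Set Y :=
  ⋂ G : {G : Set S // IsClopen G ∧ s ∈ G}, closure (Subtype.val '' G.1)

instance (S : Set Y) (s : S) : Nonempty {G : Set S // IsClopen G ∧ s ∈ G} :=
  ⟨⟨univ, isClopen_univ, mem_univ s⟩⟩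

theorem isClosed_quasiHull (S : Set Y) (s : S) : IsClosed (quasiHull S s) :=
  isClosed_iInter fun _ => isClosed_closure

theorem quasiHull_subset_closure {S : Set Y} {s : S} {G : Set S} (hG : IsClopen G) (hs : s ∈ G) :
    quasiHull S s ⊆ closure (Subtype.val '' G) :=
  iInter_subset (fun G : {G : Set S // IsClopen G ∧ s ∈ G} => closure (Subtype.val '' G.1))
    ⟨G, hG, hs⟩

theorem quasiHull_subset_closure_self (S : Set Y) (s : S) : quasiHull S s ⊆ closure S := by
  simpa using quasiHull_subset_closure (G := univ) isClopen_univ (mem_univ s)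

theorem coe_mem_quasiHull_iff {S : Set Y} {s t : S} :
    (t : Y) ∈ quasiHull S s ↔ t ∈ quasiComponent s := by
  simp only [quasiHull, mem_iInter, Subtype.forall, quasiComponent, mem_ofPred_eq, and_imp]
  refine forall_congr' fun G => forall_congr' fun hG => forall_congr' fun _ => ?_
  rw [← closure_subtype, hG.isClosed.closure_eq]

theorem mem_quasiHull_self {S : Set Y} (s : S) : (s : Y) ∈ quasiHull S s :=
  coe_mem_quasiHull_iff.2 (mem_quasiComponent_self s)

theorem directed_closure_isClopen (S : Set Y) (s : S) :
    Directed (· ⊇ ·) fun G : {G : Set S // IsClopen G ∧ s ∈ G} => closure (Subtype.val '' G.1) := by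
  rintro ⟨G, hG, hs⟩ ⟨H, hH, hs'⟩
  exact ⟨⟨G ∩ H, hG.inter hH, hs, hs'⟩, closure_mono (image_mono inter_subset_left),
    closure_mono (image_mono inter_subset_right)⟩

theorem exists_isClopen_closure_subset [CompactSpace Y] {S : Set Y} {s : S} {O : Set Y}
    (hO : IsOpen O) (h : quasiHull S s ⊆ O) :
    ∃ G : Set S, IsClopen G ∧ s ∈ G ∧ closure (Subtype.val '' G) ⊆ O := by
  obtain ⟨⟨G, hG, hs⟩, hGO⟩ := exists_subset_nhds_of_compactSpace (directed_closure_isClopen S s)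
    (fun _ => isClosed_closure) fun x hx => hO.mem_nhds (h hx)
  exact ⟨G, hG, hs, hGO⟩

/-- If disjoint open sets cover a clopen set `G`, the part of `G` in either one is again clopen, so
it takes part in the intersection. -/
theorem isConnected_quasiHull [CompactSpace Y] [NormalSpace Y] (S : Set Y) (s : S) :
    IsConnected (quasiHull S s) := by
  refine isConnected_iInter_of_directed (directed_closure_isClopen S s)
    (fun _ => isClosed_closure) (mem_quasiHull_self s) ?_
  rintro O₁ O₂ h₁ h₂ hO hs ⟨G, hG, hsG⟩ hcov
  have hGcov : ∀ x ∈ G, (x : Y) ∈ O₁ ∪ O₂ := fun x hx =>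
    hcov (subset_closure (mem_image_of_mem _ hx))
  refine ⟨⟨G ∩ Subtype.val ⁻¹' O₁, ⟨?_, ?_⟩, hsG, hs⟩, ?_⟩
  · have : G ∩ Subtype.val ⁻¹' O₁ = G ∩ Subtype.val ⁻¹' O₂ᶜ := by
      ext x
      refine and_congr_right fun hx => ⟨fun h h' => disjoint_left.1 hO h h', fun h => ?_⟩
      exact (hGcov x hx).resolve_right h
    rw [this]
    exact hG.isClosed.inter (h₂.isClosed_compl.preimage continuous_subtype_val)
  · exact hG.isOpen.inter (h₁.preimage continuous_subtype_val)
  · exact closure_mono (image_subset_iff.2 inter_subset_right)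

end QuasiComponents

/-! ### Absorption makes quasi-components connected. -/

section Absorbing

variable {Y : Type*} [TopologicalSpace Y]

/-- A set absorbs nowhere dense continua if it contains every closed connected nowhere dense set
that it meets. -/
def AbsorbsNowhereDense (X : Set Y) : Prop :=
  ∀ L : Set Y, IsClosed L → IsConnected L → interior L = ∅ → (L ∩ X).Nonempty → L ⊆ X

/-- Near a point `r` of a quasi-component `R`, the hulls of the other quasi-components follow the
component of `r`: they lie in every open set that contains all continua of `S` through `r`. -/
theorem exists_nhd_forall_quasiHull_subset [CompactSpace Y] [NormalSpace Y] {X S : Set Y}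
    (habs : AbsorbsNowhereDense X) (hSX : S ⊆ X) (hScl : closure S ∩ X ⊆ S)
    (r : S) {O : Set Y} (hO : IsOpen O)
    (hrO : ∀ L : Set Y, IsConnected L → (r : Y) ∈ L → L ⊆ S → L ⊆ O) :
    ∃ B : Set Y, IsOpen B ∧ (r : Y) ∈ B ∧
      ∀ s ∉ quasiComponent r, (quasiHull S s ∩ B).Nonempty → quasiHull S s ⊆ O := by
  by_contra! hcon
  let ι := {B : Set Y // IsOpen B ∧ (r : Y) ∈ B}
  -- The intersection `L` of the closures of `T B` is the limit at `r` of the other hulls.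
  let T : Set Y → Set Y := fun B =>
    ⋃ s ∈ {s : S | s ∉ quasiComponent r ∧ (quasiHull S s ∩ B).Nonempty}, quasiHull S s
  have hTmono : ∀ {B B' : Set Y}, B ⊆ B' → T B ⊆ T B' := fun h =>
    biUnion_subset_biUnion_left fun s hs => ⟨hs.1, hs.2.mono (inter_subset_inter_right _ h)⟩
  have hTsub : ∀ {B A : Set Y}, (∀ s ∉ quasiComponent r, (quasiHull S s ∩ B).Nonempty →
      quasiHull S s ⊆ A) → T B ⊆ A := fun h => iUnion₂_subset fun s hs => h s hs.1 hs.2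
  have hne : Nonempty ι := ⟨⟨univ, isOpen_univ, mem_univ _⟩⟩
  have hdir : Directed (· ⊇ ·) fun B : ι => closure (T B.1) := by
    rintro ⟨B, hB, hrB⟩ ⟨B', hB', hrB'⟩
    exact ⟨⟨B ∩ B', hB.inter hB', hrB, hrB'⟩, closure_mono (hTmono inter_subset_left),
      closure_mono (hTmono inter_subset_right)⟩
  have hrT : ∀ B : ι, (r : Y) ∈ closure (T B.1) := by
    rintro ⟨B, hB, hrB⟩
    rw [mem_closure_iff]
    intro B' hB' hrB'
    obtain ⟨s, hs, ⟨x, hx, hxB⟩, -⟩ := hcon (B ∩ B') (hB.inter hB') ⟨hrB, hrB'⟩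
    exact ⟨x, hxB.2, mem_biUnion (show s ∈ {s : S | _} from ⟨hs, x, hx, hxB.1⟩) hx⟩
  have hrL : (r : Y) ∈ ⋂ B : ι, closure (T B.1) := mem_iInter.2 hrT
  have hLconn : IsConnected (⋂ B : ι, closure (T B.1)) := by
    refine isConnected_iInter_of_directed hdir (fun _ => isClosed_closure) hrL ?_
    rintro O₁ O₂ h₁ h₂ hO₁₂ hr₁ ⟨B, hB, hrB⟩ hcov
    -- A connected hull that meets `O₁` and is covered by `O₁ ∪ O₂` stays in `O₁`.
    refine ⟨⟨B ∩ O₁, hB.inter h₁, hrB, hr₁⟩, closure_mono (hTsub fun s hs hsB => ?_)⟩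
    have hsO : quasiHull S s ⊆ O₁ ∪ O₂ := by
      refine Subset.trans ?_ (subset_closure.trans hcov)
      exact subset_biUnion_of_mem (u := fun s => quasiHull S s)
        (show s ∈ {s : S | _} from ⟨hs, hsB.mono (inter_subset_inter_right _ inter_subset_left)⟩)
    exact (isConnected_quasiHull S s).isPreconnected.subset_left_of_subset_union h₁ h₂ hO₁₂ hsO
      (hsB.mono (inter_subset_inter_right _ inter_subset_right))
  set L : Set Y := ⋂ B : ι, closure (T B.1) with hLdef
  have hLcl : IsClosed L := isClosed_iInter fun _ => isClosed_closure
  have hLS : L ⊆ closure S := by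
    refine (iInter_subset _ (⟨univ, isOpen_univ, mem_univ _⟩ : ι)).trans ?_
    exact closure_minimal (hTsub fun s _ _ => quasiHull_subset_closure_self S s) isClosed_closure
  -- For clopen `G` containing `r`, the complement of the closure of `Gᶜ` is a neighbourhood of `r`;
  -- only hulls of points of `G` meet it.
  have hLR : ∀ y : S, (y : Y) ∈ L → y ∈ quasiComponent r := by
    intro y hy G hG hrG
    have hB : (r : Y) ∈ (closure (Subtype.val '' Gᶜ))ᶜ := fun h => by
      rw [← closure_subtype, hG.compl.isClosed.closure_eq] at h
      exact h hrG
    have hTG : T (closure (Subtype.val '' Gᶜ))ᶜ ⊆ closure (Subtype.val '' G) := by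
      refine hTsub fun s _ hsB => ?_
      by_cases hsG : s ∈ G
      · exact quasiHull_subset_closure hG hsG
      · obtain ⟨x, hx, hxB⟩ := hsB
        exact absurd (quasiHull_subset_closure hG.compl hsG hx) hxB
    have hyG : (y : Y) ∈ closure (Subtype.val '' G) :=
      closure_minimal hTG isClosed_closure
        (mem_iInter.1 hy ⟨_, isClosed_closure.isOpen_compl, hB⟩)
    rwa [← closure_subtype, hG.isClosed.closure_eq] at hyG
  -- An open set inside `L` would meet the hull of some `s` outside the quasi-component, hence a
  -- clopen set around `s` that misses it, against `hLR`.
  have hLint : interior L = ∅ := by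
    rw [← not_nonempty_iff_eq_empty]
    intro hP
    obtain ⟨p, hp⟩ := hP
    have hpT : p ∈ closure (T univ) :=
      mem_iInter.1 (interior_subset hp) ⟨univ, isOpen_univ, mem_univ _⟩
    obtain ⟨q, hqP, hqT⟩ := mem_closure_iff.1 hpT _ isOpen_interior hp
    obtain ⟨s, ⟨hs, -⟩, hqs⟩ := mem_iUnion₂.1 hqT
    obtain ⟨G, hG, hsG, hGR⟩ := exists_isClopen_disjoint_quasiComponent hs
    obtain ⟨_, hzP, z, hzG, rfl⟩ := mem_closure_iff.1 (quasiHull_subset_closure hG hsG hqs) _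
      isOpen_interior hqP
    exact disjoint_left.1 hGR hzG (hLR z (interior_subset hzP))
  have hLX : L ⊆ X := habs L hLcl hLconn hLint ⟨r, hrL, hSX r.2⟩
  have hLO : L ⊆ O := hrO L hLconn hrL fun x hx => hScl ⟨hLS hx, hLX hx⟩
  obtain ⟨⟨B, hB, hrB⟩, hBO⟩ := exists_subset_nhds_of_compactSpace hdir
    (fun _ => isClosed_closure) fun x hx => hO.mem_nhds (hLO hx)
  obtain ⟨s, hs, hsB, hsO⟩ := hcon B hB hrB
  refine hsO (Subset.trans ?_ (subset_closure.trans hBO))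
  exact subset_biUnion_of_mem (u := fun s => quasiHull S s)
    (show s ∈ {s : S | _} from ⟨hs, hsB⟩)

end Absorbing

section Absorbing

theorem quasiComponent_eq {S : Type*} [TopologicalSpace S] {s t : S} (h : t ∈ quasiComponent s) :
    quasiComponent t = quasiComponent s := by
  ext z
  refine ⟨fun hz G hG hs => hz G hG (h G hG hs), fun hz G hG ht => hz G hG ?_⟩
  by_contra hs
  exact h Gᶜ hG.compl hs ht

variable {Y : Type*} [TopologicalSpace Y]

/-- If `X` absorbs nowhere dense continua, then the quasi-components of each relatively closed
subset of `X` are connected. -/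
theorem isPreconnected_quasiComponent [CompactSpace Y] [T3Space Y] [SecondCountableTopology Y]
    {X S : Set Y} (habs : AbsorbsNowhereDense X) (hSX : S ⊆ X) (hScl : closure S ∩ X ⊆ S) (x : S) :
    IsPreconnected (quasiComponent x) := by
  intro u v hu hv huv hRu hRv
  by_contra hempty
  rw [not_nonempty_iff_eq_empty] at hempty
  set R := quasiComponent x with hR
  have hnot : ∀ t ∈ R, t ∈ u → t ∉ v := fun t ht htu htv =>
    (hempty ▸ (⟨ht, htu, htv⟩ : t ∈ R ∩ (u ∩ v)) : t ∈ (∅ : Set S))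
  have hsep : ∀ {u v : Set S}, IsOpen v → (∀ t ∈ R, t ∈ u → t ∉ v) →
      Disjoint (closure (Subtype.val '' (R ∩ u))) ((Subtype.val : S → Y) '' (R ∩ v)) := by
    intro u v hv h
    rw [disjoint_right]
    rintro _ ⟨t, ⟨-, htv⟩, rfl⟩ ht
    rw [← closure_subtype] at ht
    obtain ⟨z, hzv, hzR, hzu⟩ := mem_closure_iff.1 ht v hv htv
    exact h z hzR hzu hzv
  obtain ⟨O₁, O₂, hO₁, hO₂, hR₁, hR₂, hO⟩ := separatedNhds_iff_disjoint.2 <|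
    CompletelyNormalSpace.completely_normal (hsep hv hnot)
      (hsep hu fun t ht htv htu => hnot t ht htu htv).symm
  replace hR₁ : ∀ t ∈ R, t ∈ u → (t : Y) ∈ O₁ := fun t ht htu => hR₁ ⟨t, ⟨ht, htu⟩, rfl⟩
  replace hR₂ : ∀ t ∈ R, t ∈ v → (t : Y) ∈ O₂ := fun t ht htv => hR₂ ⟨t, ⟨ht, htv⟩, rfl⟩
  -- Continua of `S` through `r` stay in `R`, hence in `O₁ ∪ O₂`, hence in `O₁`.
  have hlocal : ∀ r ∈ R ∩ u, ∃ D : Set Y, IsClosed D ∧ D ∈ 𝓝 (r : Y) ∧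
      ∀ s ∉ R, (quasiHull S s ∩ D).Nonempty → quasiHull S s ⊆ O₁ := by
    rintro r ⟨hrR, hru⟩
    obtain ⟨B, hB, hrB, h⟩ := exists_nhd_forall_quasiHull_subset habs hSX hScl r hO₁ (by
      intro L hL hrL hLS
      refine hL.isPreconnected.subset_left_of_subset_union hO₁ hO₂ hO (fun y hy => ?_)
        ⟨r, hrL, hR₁ r hrR hru⟩
      have hpre : IsPreconnected (Subtype.val ⁻¹' L : Set S) := by
        rw [← IsInducing.subtypeVal.isPreconnected_image, Subtype.image_preimage_coe,
          inter_eq_right.2 hLS]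
        exact hL.isPreconnected
      have hyR : (⟨y, hLS hy⟩ : S) ∈ R := by
        rw [hR, ← quasiComponent_eq hrR]
        exact IsPreconnected.subset_quasiComponent hpre hrL hy
      exact (huv hyR).imp (hR₁ _ hyR) (hR₂ _ hyR))
    obtain ⟨D, ⟨hDr, hD⟩, hDB⟩ := (closed_nhds_basis (r : Y)).mem_iff.1 (hB.mem_nhds hrB)
    rw [quasiComponent_eq hrR] at h
    exact ⟨D, hD, hDr, fun s hs hsD => h s hs (hsD.mono (inter_subset_inter_right _ hDB))⟩
  choose! D hDcl hDnhds hD using hlocal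
  obtain ⟨c, hcR, hcc, hccov⟩ := TopologicalSpace.countable_cover_nhdsWithin (s := R ∩ u)
    (f := fun r => Subtype.val ⁻¹' interior (D r)) fun r hr => mem_nhdsWithin_of_mem_nhds
      (continuous_subtype_val.continuousAt.preimage_mem_nhds
        (interior_mem_nhds.2 (hDnhds r hr)))
  have hcne : c.Nonempty := by
    obtain ⟨t, ht⟩ := hRu
    obtain ⟨r, hr, -⟩ := mem_iUnion₂.1 (hccov ht)
    exact ⟨r, hr⟩
  obtain ⟨e, rfl⟩ := hcc.exists_eq_range hcne
  obtain ⟨E, hEcl, hER, hEd, hEcov⟩ := exists_seq_disjoint_isClopen_cover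
    (P := fun G => Disjoint G R) (disjoint_bot_left) (fun G H h hG => hG.mono_left h)
    (T := Rᶜ) fun t ht => exists_isClopen_disjoint_quasiComponent ht
  -- Only the first `i + 1` neighbourhoods are avoided, so that their union is closed.
  have hsplit : ∀ i, ∃ F ⊆ E i, IsClopen F ∧ F ⊆ Subtype.val ⁻¹' O₁ ∧
      E i \ F ⊆ (Subtype.val ⁻¹' ⋃ k ∈ Iic i, D (e k))ᶜ := by
    intro i
    refine exists_isClopen_split (hEcl i) fun s hs => ?_
    have hsR : s ∉ R := fun h => disjoint_left.1 (hER i) hs h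
    by_cases hmeet : (quasiHull S s ∩ ⋃ k ∈ Iic i, D (e k)).Nonempty
    · obtain ⟨z, hz, hzD⟩ := hmeet
      obtain ⟨k, -, hzk⟩ := mem_iUnion₂.1 hzD
      obtain ⟨G, hG, hsG, hGO⟩ := exists_isClopen_closure_subset hO₁
        (hD (e k) (hcR (mem_range_self k)) s hsR ⟨z, hz, hzk⟩)
      exact ⟨G, hG, hsG, Or.inl fun g hg => hGO (subset_closure (mem_image_of_mem _ hg))⟩
    · have hQ : IsClosed (⋃ k ∈ Iic i, D (e k)) :=
        (finite_Iic i).isClosed_biUnion fun k _ => hDcl _ (hcR (mem_range_self k))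
      obtain ⟨G, hG, hsG, hGO⟩ := exists_isClopen_closure_subset hQ.isOpen_compl
        (fun z hz hzQ => hmeet ⟨z, hz, hzQ⟩)
      exact ⟨G, hG, hsG, Or.inr fun g hg => hGO (subset_closure (mem_image_of_mem _ hg))⟩
  choose F hFE hFcl hFO hFQ using hsplit
  have hA : IsClopen (R ∩ u ∪ ⋃ i, F i) := by
    constructor
    · rw [← isOpen_compl_iff, isOpen_iff_mem_nhds]
      intro t ht
      by_cases htR : t ∈ R
      · have htv : t ∈ v := (huv htR).resolve_left fun htu => ht (Or.inl ⟨htR, htu⟩)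
        filter_upwards [(hO₂.preimage continuous_subtype_val).mem_nhds (hR₂ t htR htv)] with z hz
        rintro (⟨hzR, hzu⟩ | hzF)
        · exact disjoint_left.1 hO (hR₁ z hzR hzu) hz
        · obtain ⟨i, hi⟩ := mem_iUnion.1 hzF
          exact disjoint_left.1 hO (hFO i hi) hz
      · obtain ⟨i, hi⟩ := mem_iUnion.1 (hEcov htR)
        have htF : t ∉ F i := fun h => ht (Or.inr (mem_iUnion.2 ⟨i, h⟩))
        filter_upwards [((hEcl i).isOpen.sdiff (hFcl i).isClosed).mem_nhds ⟨hi, htF⟩] with z hz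
        rintro (⟨hzR, -⟩ | hzF)
        · exact disjoint_left.1 (hER i) hz.1 hzR
        · obtain ⟨j, hj⟩ := mem_iUnion.1 hzF
          rcases eq_or_ne i j with rfl | hij
          · exact hz.2 hj
          · exact disjoint_left.1 (hEd hij) hz.1 (hFE j hj)
    · rw [isOpen_iff_mem_nhds]
      rintro t (⟨htR, htu⟩ | htF)
      · obtain ⟨_, ⟨k, rfl⟩, htk⟩ := mem_iUnion₂.1 (hccov ⟨htR, htu⟩)
        -- Near `t` the finitely many `E i` with `i < k` can be avoided; for `i ≥ k`, points of `E
        -- i` in `D (e k)` belong to `F i`.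
        have hopen : IsOpen (⋂ i ∈ Iio k, (E i)ᶜ) :=
          (finite_Iio k).isOpen_biInter fun i _ => (hEcl i).compl.isOpen
        have htE : t ∈ ⋂ i ∈ Iio k, (E i)ᶜ :=
          mem_iInter₂.2 fun i _ hi => disjoint_left.1 (hER i) hi htR
        filter_upwards [hopen.mem_nhds htE,
          (hO₁.preimage continuous_subtype_val).mem_nhds (hR₁ t htR htu),
          (isOpen_interior.preimage continuous_subtype_val).mem_nhds htk] with z hzE hzO hzD
        by_cases hzR : z ∈ R
        · exact Or.inl ⟨hzR, (huv hzR).resolve_right fun hzv =>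
            disjoint_left.1 hO hzO (hR₂ z hzR hzv)⟩
        · obtain ⟨i, hi⟩ := mem_iUnion.1 (hEcov hzR)
          have hki : k ≤ i := not_lt.1 fun h => mem_iInter₂.1 hzE i h hi
          refine Or.inr (mem_iUnion.2 ⟨i, ?_⟩)
          by_contra hzF
          exact hFQ i ⟨hi, hzF⟩ (mem_biUnion hki (interior_subset hzD))
      · obtain ⟨i, hi⟩ := mem_iUnion.1 htF
        exact Filter.mem_of_superset ((hFcl i).isOpen.mem_nhds hi)
          ((subset_iUnion F i).trans subset_union_right)
  obtain ⟨p, hpR, hpu⟩ := hRu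
  obtain ⟨q, hqR, hqv⟩ := hRv
  have hpA : q ∈ quasiComponent p := by rw [quasiComponent_eq hpR]; exact hqR
  rcases hpA _ hA (Or.inl ⟨hpR, hpu⟩) with h | h
  · exact hnot q hqR h.2 hqv
  · obtain ⟨i, hi⟩ := mem_iUnion.1 h
    exact disjoint_left.1 (hER i) (hFE i hi) hqR

end Absorbing

theorem coe_image_eq_iff {Y : Type*} {Z : Set Y} {C : Set Z} : Subtype.val '' C = Z ↔ C = univ := by
  constructor
  · intro h
    ext z
    obtain ⟨w, hw, hwz⟩ : (z : Y) ∈ Subtype.val '' C := h.symm.subset z.2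
    simpa [← Subtype.ext hwz] using hw
  · rintro rfl
    simp

/-! ### Translation from subspaces to subsets of the ambient space. -/

section RelativelyClosed

variable {Y : Type*} [TopologicalSpace Y]

theorem isConnected_coe_image_iff {Z : Set Y} {C : Set Z} :
    IsConnected (Subtype.val '' C) ↔ IsConnected C := by
  rw [IsConnected, IsConnected, IsInducing.subtypeVal.isPreconnected_image, image_nonempty]

theorem isConnected_preimage_coe_iff {Z C : Set Y} (h : C ⊆ Z) :
    IsConnected (Subtype.val ⁻¹' C : Set Z) ↔ IsConnected C := by
  rw [← isConnected_coe_image_iff, Subtype.image_preimage_coe, inter_eq_right.2 h]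

theorem isClosed_iff_closure_coe_image {Z : Set Y} {C : Set Z} :
    IsClosed C ↔ closure (Subtype.val '' C) ∩ Z ⊆ Subtype.val '' C := by
  rw [← closure_subset_iff_isClosed]
  constructor
  · rintro h y ⟨hy, hyZ⟩
    exact ⟨⟨y, hyZ⟩, h (closure_subtype.2 hy), rfl⟩
  · intro h y hy
    obtain ⟨z, hz, hzy⟩ := h ⟨closure_subtype.1 hy, y.2⟩
    rwa [← Subtype.ext hzy]

theorem isClosed_preimage_coe_iff {Z C : Set Y} (h : C ⊆ Z) :
    IsClosed (Subtype.val ⁻¹' C : Set Z) ↔ closure C ∩ Z ⊆ C := by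
  rw [isClosed_iff_closure_coe_image, Subtype.image_preimage_coe, inter_eq_right.2 h]

theorem isIndecomposable_of_forall_union_eq {Z : Set Y} (hZ : IsConnected Z)
    (h : ∀ H K : Set Y, IsConnected H → IsConnected K → closure H ∩ Z ⊆ H → closure K ∩ Z ⊆ K →
      H ∪ K = Z → H = Z ∨ K = Z) : IsIndecomposable Z := by
  refine ⟨isConnected_iff_connectedSpace.1 hZ, ?_⟩
  rintro ⟨H, K, hHcl, hH, hHne, hKcl, hK, hKne, hHK⟩
  rcases h _ _ (isConnected_coe_image_iff.2 hH) (isConnected_coe_image_iff.2 hK)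
    (isClosed_iff_closure_coe_image.1 hHcl) (isClosed_iff_closure_coe_image.1 hKcl)
    (by rw [← image_union, hHK, coe_image_eq_iff]) with h' | h'
  · exact hHne (coe_image_eq_iff.1 h')
  · exact hKne (coe_image_eq_iff.1 h')

theorem isIrreducibleConnected_iff {Z : Set Y} : IsIrreducibleConnected Z ↔
    IsConnected Z ∧ ∃ p ∈ Z, ∃ q ∈ Z, ∀ C ⊆ Z, IsConnected C → closure C ∩ Z ⊆ C →
      p ∈ C → q ∈ C → C = Z := by
  rw [IsIrreducibleConnected, ← isConnected_iff_connectedSpace]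
  refine and_congr_right fun _ => ⟨?_, ?_⟩
  · rintro ⟨p, q, h⟩
    refine ⟨p, p.2, q, q.2, fun C hCZ hC hCcl hp hq => ?_⟩
    have := h _ ((isClosed_preimage_coe_iff hCZ).2 hCcl) ((isConnected_preimage_coe_iff hCZ).2 hC)
      hp hq
    rwa [← coe_image_eq_iff, Subtype.image_preimage_coe, inter_eq_right.2 hCZ] at this
  · rintro ⟨p, hp, q, hq, h⟩
    refine ⟨⟨p, hp⟩, ⟨q, hq⟩, fun C hCcl hC hpC hqC => coe_image_eq_iff.1 ?_⟩
    exact h _ (Subtype.coe_image_subset Z C) (isConnected_coe_image_iff.2 hC)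
      (isClosed_iff_closure_coe_image.1 hCcl) ⟨_, hpC, rfl⟩ ⟨_, hqC, rfl⟩

end RelativelyClosed

/-! ### Consequences of and criteria for indecomposability. -/

section Indecomposable

/-- In a connected space, the union of a connected closed set with one side of a separation of its
complement is connected. -/
theorem isConnected_compl_of_separation {Z : Type*} [TopologicalSpace Z] [ConnectedSpace Z]
    {C A B : Set Z} (hC : IsConnected C) (hA : IsOpen A) (hB : IsOpen B) (hAB : Disjoint A B)
    (hCAB : Cᶜ = A ∪ B) : IsConnected Bᶜ := by
  have hCB : C ⊆ Bᶜ := fun x hx hxB => by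
    have : x ∈ Cᶜ := hCAB ▸ Or.inr hxB
    exact this hx
  refine ⟨hC.nonempty.mono hCB, ?_⟩
  have key : ∀ t t' : Set Z, IsClosed t → IsClosed t' → Bᶜ ⊆ t ∪ t' → Bᶜ ∩ (t ∩ t') = ∅ →
      C ⊆ t → Bᶜ ⊆ t := by
    intro t t' ht ht' hcov hd hCt
    have heq : Bᶜ ∩ t' = A ∩ tᶜ := by
      ext x
      constructor
      · rintro ⟨hxB, hxt'⟩
        have hxt : x ∉ t := fun hxt =>
          (hd ▸ (⟨hxB, hxt, hxt'⟩ : x ∈ Bᶜ ∩ (t ∩ t')) : x ∈ (∅ : Set Z))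
        have hxC : x ∈ Cᶜ := fun hxC => hxt (hCt hxC)
        rw [hCAB] at hxC
        exact ⟨hxC.resolve_right hxB, hxt⟩
      · rintro ⟨hxA, hxt⟩
        have hxB : x ∈ Bᶜ := fun hxB => disjoint_left.1 hAB hxA hxB
        exact ⟨hxB, (hcov hxB).resolve_left hxt⟩
    have hclopen : IsClopen (Bᶜ ∩ t') :=
      ⟨hB.isClosed_compl.inter ht', heq ▸ hA.inter ht.isOpen_compl⟩
    rcases isClopen_iff.1 hclopen with h | h
    · intro x hx
      refine (hcov hx).resolve_right fun hxt' => ?_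
      exact (h ▸ (⟨hx, hxt'⟩ : x ∈ Bᶜ ∩ t') : x ∈ (∅ : Set Z))
    · obtain ⟨c, hc⟩ := hC.nonempty
      have : c ∈ Bᶜ ∩ t' := h ▸ mem_univ c
      rw [heq] at this
      exact absurd (hCt hc) this.2
  rw [isPreconnected_iff_subset_of_disjoint_closed]
  intro t t' ht ht' hcov hd
  rcases isPreconnected_iff_subset_of_disjoint_closed.1 hC.isPreconnected t t' ht ht'
    (hCB.trans hcov) (subset_empty_iff.1 (hd ▸ inter_subset_inter_left _ hCB)) with h | h
  · exact Or.inl (key t t' ht ht' hcov hd h)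
  · exact Or.inr (key t' t ht' ht (by rwa [union_comm]) (by rwa [inter_comm t' t]) h)

/-- For proper `C`, either `Cᶜ` is connected and its closure decomposes `Z` together with `C`, or
`Cᶜ` separates and `C` joined with each side gives a decomposition. -/
theorem IsIndecomposable.eq_univ {Z : Type*} [TopologicalSpace Z] (hZ : IsIndecomposable Z)
    {C : Set Z} (hCcl : IsClosed C) (hC : IsConnected C) (hint : (interior C).Nonempty) :
    C = univ := by
  have := hZ.1
  by_contra hne
  refine hZ.2 ?_
  by_cases hpre : IsPreconnected Cᶜ
  · refine ⟨C, closure Cᶜ, hCcl, hC, hne, isClosed_closure,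
      ⟨(nonempty_compl.2 hne).closure, hpre.closure⟩, ?_, ?_⟩
    · rw [closure_compl, Ne, compl_univ_iff]
      exact hint.ne_empty
    · exact univ_subset_iff.1 ((union_compl_self C).symm.subset.trans
        (union_subset_union_right _ subset_closure))
  · rw [IsPreconnected] at hpre
    push Not at hpre
    obtain ⟨u, v, hu, hv, huv, hCu, hCv, hd⟩ := hpre
    have hdisj : Disjoint (Cᶜ ∩ u) (Cᶜ ∩ v) := disjoint_left.2 fun x hx hx' =>
      (hd ▸ (⟨hx.1, hx.2, hx'.2⟩ : x ∈ Cᶜ ∩ (u ∩ v)) : x ∈ (∅ : Set Z))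
    have hcov : Cᶜ = Cᶜ ∩ u ∪ Cᶜ ∩ v := by rw [← inter_union_distrib_left, inter_eq_left.2 huv]
    have hA := hCcl.isOpen_compl.inter hu
    have hB := hCcl.isOpen_compl.inter hv
    refine ⟨(Cᶜ ∩ v)ᶜ, (Cᶜ ∩ u)ᶜ, hB.isClosed_compl,
      isConnected_compl_of_separation hC hA hB hdisj hcov, ?_, hA.isClosed_compl,
      isConnected_compl_of_separation hC hB hA hdisj.symm (by rw [union_comm]; exact hcov), ?_, ?_⟩
    · rw [Ne, compl_univ_iff]; exact hCv.ne_empty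
    · rw [Ne, compl_univ_iff]; exact hCu.ne_empty
    · rw [← compl_inter, hdisj.symm.inter_eq, compl_empty]

variable {Y : Type*} [TopologicalSpace Y] {X : Set Y}

theorem IsIndecomposable.isConnected (h : IsIndecomposable X) : IsConnected X :=
  isConnected_iff_connectedSpace.2 h.1

theorem IsIndecomposable.subset_closure_of_interior_nonempty (hX : IsIndecomposable X)
    (hdense : Dense X) {C : Set Y} (hCX : C ⊆ X) (hC : IsConnected C) (hint : (interior (closure C)).Nonempty) :
    X ⊆ closure C := by
  have hcl : (Subtype.val ⁻¹' closure C : Set X) = closure (Subtype.val ⁻¹' C) := by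
    ext x
    rw [closure_subtype, Subtype.image_preimage_coe, inter_eq_right.2 hCX, mem_preimage]
  have huniv : (Subtype.val ⁻¹' closure C : Set X) = univ := by
    refine hX.eq_univ (isClosed_closure.preimage continuous_subtype_val) ?_ ?_
    · rw [hcl]
      exact ((isConnected_preimage_coe_iff hCX).2 hC).closure
    · obtain ⟨x, hx, hxX⟩ := hdense.inter_open_nonempty _ isOpen_interior hint
      exact ⟨⟨x, hxX⟩, interior_maximal (preimage_mono interior_subset)
        (isOpen_interior.preimage continuous_subtype_val) hx⟩
  intro x hx
  exact (huniv ▸ mem_univ (⟨x, hx⟩ : X) : (⟨x, hx⟩ : X) ∈ (Subtype.val ⁻¹' closure C : Set X))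

theorem IsStronglyIndecomposable.isIndecomposable {Z : Type*} [TopologicalSpace Z]
    (h : IsStronglyIndecomposable Z) : IsIndecomposable Z := by
  refine ⟨h.1, ?_⟩
  rintro ⟨H, K, hHcl, hH, hHne, hKcl, hK, hKne, hHK⟩
  have hcov : ∀ x, x ∈ H ∨ x ∈ K := fun x => (hHK ▸ mem_univ x : x ∈ H ∪ K)
  -- A decomposition makes `Hᶜ` and `Kᶜ` disjoint, and the resulting splitting separates the
  -- connected set `H`.
  obtain ⟨A, B, hA, hB, hAB, hcup, ⟨a, ha, -⟩, ⟨b, hb, -⟩⟩ := h.2 Hᶜ Kᶜ hHcl.isOpen_compl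
    hKcl.isOpen_compl (nonempty_compl.2 hHne) (nonempty_compl.2 hKne)
    (disjoint_left.2 fun x hx hx' => (hcov x).elim hx hx')
  rw [compl_compl] at hcup
  obtain ⟨x, -, hxA, hxB⟩ := isPreconnected_closed_iff.1 hH.isPreconnected A B hA hB hcup.subset
    ⟨a, hcup ▸ Or.inl ha, ha⟩ ⟨b, hcup ▸ Or.inr hb, hb⟩
  exact disjoint_left.1 hAB hxA hxB

theorem IsSingularWrt.isIndecomposable (hdense : Dense X) {y : Y} (h : IsSingularWrt X y) :
    IsIndecomposable X := by
  refine isIndecomposable_of_forall_union_eq h.1 fun H K hH hK hHcl hKcl hHK => ?_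
  have key : ∀ C, C ⊆ X → IsConnected C → closure C ∩ X ⊆ C → y ∈ closure C → C = X :=
    fun C hCX hC hCcl hy => hCX.antisymm ((h.2 C hCX hC hy).symm.subset.trans hCcl)
  have hy : y ∈ closure (H ∪ K) := hHK ▸ hdense y
  rw [closure_union] at hy
  exact hy.imp (key H (hHK ▸ subset_union_left) hH hHcl) (key K (hHK ▸ subset_union_right) hK hKcl)

end Indecomposable

/-! ### Dense absorbing sets and meager composants. -/

section DenseMeagerComposant

variable {Y : Type*} [TopologicalSpace Y]

theorem interior_union_eq_empty {s t : Set Y} (hs : IsClosed s) (hs' : interior s = ∅)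
    (ht : interior t = ∅) : interior (s ∪ t) = ∅ := by
  rw [interior_union_isClosed_of_interior_empty hs ht, hs']

theorem isConnected_meagerComposant {x : Y} (h : (meagerComposant x).Nonempty) :
    IsConnected (meagerComposant x) :=
  ⟨h, isPreconnected_sUnion x _ (fun _ hK => hK.2.2) fun _ hK => hK.1.2.isPreconnected⟩

theorem absorbsNowhereDense_meagerComposant [CompactSpace Y] [T2Space Y] (x : Y) :
    AbsorbsNowhereDense (meagerComposant x) := by
  rintro L hL hLc hLi ⟨z, hzL, K, ⟨⟨hKcomp, hKc⟩, hKn, hxK⟩, hzK⟩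
  have hKcl := hKcomp.isClosed
  rw [IsNowhereDense, hKcl.closure_eq] at hKn
  refine subset_union_left.trans (subset_sUnion_of_mem (t := L ∪ K) ⟨⟨(hL.union hKcl).isCompact,
    hLc.union ⟨z, hzL, hzK⟩ hKc⟩, ?_, Or.inr hxK⟩)
  rw [IsNowhereDense, (hL.union hKcl).closure_eq]
  exact interior_union_eq_empty hL hLi hKn

theorem exists_nowhereDense_continuum [T2Space Y] {x p q : Y} (hp : p ∈ meagerComposant x)
    (hq : q ∈ meagerComposant x) :
    ∃ M ⊆ meagerComposant x, IsClosed M ∧ IsConnected M ∧ interior M = ∅ ∧ p ∈ M ∧ q ∈ M := by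
  obtain ⟨K, hK, hpK⟩ := hp
  obtain ⟨L, hL, hqL⟩ := hq
  have hKcl := hK.1.1.isClosed
  have hLcl := hL.1.1.isClosed
  refine ⟨K ∪ L, union_subset (subset_sUnion_of_mem hK) (subset_sUnion_of_mem hL),
    hKcl.union hLcl, hK.1.2.union ⟨x, hK.2.2, hL.2.2⟩ hL.1.2, ?_, Or.inl hpK, Or.inr hqL⟩
  refine interior_union_eq_empty hKcl ?_ ?_
  · simpa [IsNowhereDense, hKcl.closure_eq] using hK.2.1
  · simpa [IsNowhereDense, hLcl.closure_eq] using hL.2.1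

variable {X : Set Y}

theorem IsIndecomposable.isStronglyIndecomposable [CompactSpace Y] [T3Space Y]
    [SecondCountableTopology Y] (habs : AbsorbsNowhereDense X) (hX : IsIndecomposable X) :
    IsStronglyIndecomposable X := by
  refine ⟨hX.1, fun U V hU hV hUne ⟨v, hv⟩ hUV => ?_⟩
  by_contra! hcon
  let S : Set Y := Subtype.val '' Uᶜ
  have hSX : S ⊆ X := Subtype.coe_image_subset X Uᶜ
  have hScl : closure S ∩ X ⊆ S := isClosed_iff_closure_coe_image.1 hU.isClosed_compl
  have hVS : ∀ w ∈ V, (w : Y) ∈ S := fun w hw => ⟨w, fun hwU => disjoint_left.1 hUV hwU hw, rfl⟩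
  let s : S := ⟨v, hVS v hv⟩
  let j : S → X := fun t => ⟨t, hSX t.2⟩
  have hj : Continuous j := continuous_subtype_val.subtype_mk _
  have hjcl : IsClosedEmbedding j := by
    refine ⟨IsEmbedding.inclusion hSX, ?_⟩
    have : range j = Uᶜ := by
      ext z
      constructor
      · rintro ⟨⟨_, w, hw, rfl⟩, rfl⟩
        exact hw
      · exact fun hz => ⟨⟨z, z, hz, rfl⟩, rfl⟩
    rw [this]
    exact hU.isClosed_compl
  -- A clopen subset of `S` separating two points of `V` would give the splitting that `hcon`
  -- excludes.
  have hVR : V ⊆ j '' quasiComponent s := by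
    intro w hw
    refine ⟨⟨w, hVS w hw⟩, fun G hG hsG => ?_, rfl⟩
    by_contra hwG
    have hne : (j '' Gᶜ ∩ V).Nonempty := ⟨w, ⟨_, hwG, rfl⟩, hw⟩
    refine hne.ne_empty (hcon (j '' G) (j '' Gᶜ) (hjcl.isClosedMap _ hG.isClosed)
      (hjcl.isClosedMap _ hG.compl.isClosed) ?_ ?_ ⟨v, ⟨s, hsG, rfl⟩, hv⟩)
    · exact (disjoint_image_iff hjcl.injective).2 disjoint_compl_right
    · rw [← image_union, union_compl_self, image_univ]
      ext z
      exact ⟨fun hz => ⟨⟨z, z, hz, rfl⟩, rfl⟩, by rintro ⟨⟨_, w, hw, rfl⟩, rfl⟩; exact hw⟩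
  have huniv : j '' quasiComponent s = univ := by
    refine hX.eq_univ (hjcl.isClosedMap _ (isClosed_quasiComponent s))
      ⟨⟨v, hVR hv⟩, (isPreconnected_quasiComponent habs hSX hScl s).image j hj.continuousOn⟩
      ⟨v, interior_maximal hVR hV hv⟩
  obtain ⟨u, hu⟩ := hUne
  obtain ⟨⟨_, w, hw, rfl⟩, -, rfl⟩ : u ∈ j '' quasiComponent s := huniv ▸ mem_univ u
  exact hw hu

/-- A relatively closed connected subset of `X ∪ {y}` that contains `y` and a point of `X` is the
whole space. -/
theorem IsIndecomposable.eq_union_singleton [CompactSpace Y] [T3Space Y]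
    [SecondCountableTopology Y] (habs : AbsorbsNowhereDense X) (hdense : Dense X)
    (hX : IsIndecomposable X) {y p : Y} (hy : y ∉ X) {H : Set Y} (hHX : H ⊆ X ∪ {y})
    (hH : IsConnected H) (hHcl : closure H ∩ (X ∪ {y}) ⊆ H) (hyH : y ∈ H) (hpH : p ∈ H)
    (hpX : p ∈ X) : H = X ∪ {y} := by
  refine hHX.antisymm (union_subset ?_ (singleton_subset_iff.2 hyH))
  have hSX : H ∩ X ⊆ X := inter_subset_right
  have hScl : closure (H ∩ X) ∩ X ⊆ H ∩ X := fun z hz =>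
    ⟨hHcl ⟨closure_mono inter_subset_left hz.1, Or.inl hz.2⟩, hz.2⟩
  let s : ↥(H ∩ X) := ⟨p, hpH, hpX⟩
  -- A nowhere dense hull is absorbed by `X` and so misses `y`; then a clopen set around `p` has
  -- closure off `y` and disconnects `H`. Otherwise the connected quasi-component of `p` is dense in
  -- an open set, hence in `X`.
  rcases (interior (quasiHull (H ∩ X) s)).eq_empty_or_nonempty with hint | hint
  · have hhull : quasiHull (H ∩ X) s ⊆ X := habs _ (isClosed_quasiHull _ s)
      (isConnected_quasiHull _ s) hint ⟨p, mem_quasiHull_self s, hpX⟩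
    obtain ⟨G, hG, hsG, hGy⟩ := exists_isClopen_closure_subset isOpen_compl_singleton
      (fun z hz (hzy : z = y) => hy (hzy ▸ hhull hz))
    obtain ⟨z, hzH, hzG, hz⟩ := isPreconnected_closed_iff.1 hH.isPreconnected
      (closure (Subtype.val '' G)) (closure (Subtype.val '' Gᶜ) ∪ {y}) isClosed_closure
      (isClosed_closure.union isClosed_singleton) (fun z hz => by
        rcases hHX hz with hzX | hzy
        · by_cases hzG : (⟨z, hz, hzX⟩ : ↥(H ∩ X)) ∈ G
          · exact Or.inl (subset_closure ⟨_, hzG, rfl⟩)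
          · exact Or.inr (Or.inl (subset_closure ⟨_, hzG, rfl⟩))
        · exact Or.inr (Or.inr hzy))
      ⟨p, hpH, subset_closure ⟨s, hsG, rfl⟩⟩ ⟨y, hyH, Or.inr rfl⟩
    have hzy : z ≠ y := hGy hzG
    have hzX : z ∈ X := (hHX hzH).resolve_right hzy
    lift z to ↥(H ∩ X) using ⟨hzH, hzX⟩
    have hz' := hz.resolve_right hzy
    rw [← closure_subtype, hG.isClosed.closure_eq] at hzG
    rw [← closure_subtype, hG.compl.isClosed.closure_eq] at hz'
    exact absurd hzG hz'
  · have hCX : Subtype.val '' quasiComponent s ⊆ H ∩ X := Subtype.coe_image_subset _ _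
    have hC : IsConnected (Subtype.val '' quasiComponent s) := isConnected_coe_image_iff.2
      ⟨⟨s, mem_quasiComponent_self s⟩, isPreconnected_quasiComponent habs hSX hScl s⟩
    have hsub : interior (quasiHull (H ∩ X) s) ⊆ closure (Subtype.val '' quasiComponent s) := by
      refine (hdense.open_subset_closure_inter isOpen_interior).trans (closure_mono ?_)
      rintro z ⟨hz, hzX⟩
      have hzS : z ∈ H ∩ X :=
        hScl ⟨quasiHull_subset_closure_self _ s (interior_subset hz), hzX⟩
      exact ⟨⟨z, hzS⟩, coe_mem_quasiHull_iff.1 (interior_subset hz), rfl⟩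
    have hXC := hX.subset_closure_of_interior_nonempty hdense (hCX.trans hSX) hC
      (hint.mono (interior_maximal hsub isOpen_interior))
    exact fun z hz => (hScl ⟨closure_mono hCX (hXC hz), hz⟩).1

theorem isConnected_union_singleton (hX : IsConnected X) (hdense : Dense X) (y : Y) :
    IsConnected (X ∪ {y}) :=
  hX.subset_closure subset_union_left fun z _ => hdense z

theorem IsIndecomposable.isIrreducibleConnected_union_singleton [CompactSpace Y] [T3Space Y]
    [SecondCountableTopology Y] (habs : AbsorbsNowhereDense X) (hdense : Dense X)
    (hX : IsIndecomposable X) {y : Y} (hy : y ∉ X) : IsIrreducibleConnected ↥(X ∪ {y}) := by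
  obtain ⟨p, hp⟩ := hX.isConnected.nonempty
  exact isIrreducibleConnected_iff.2 ⟨isConnected_union_singleton hX.isConnected hdense y,
    p, Or.inl hp, y, Or.inr rfl, fun C hCX hC hCcl hpC hyC =>
      hX.eq_union_singleton habs hdense hy hCX hC hCcl hyC hpC hp⟩

theorem IsIndecomposable.union_singleton [CompactSpace Y] [T3Space Y]
    [SecondCountableTopology Y] (habs : AbsorbsNowhereDense X) (hdense : Dense X)
    (hX : IsIndecomposable X) (y : Y) : IsIndecomposable ↥(X ∪ {y}) := by
  by_cases hy : y ∈ X
  · rwa [union_eq_left.2 (singleton_subset_iff.2 hy)]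
  refine isIndecomposable_of_forall_union_eq
    (isConnected_union_singleton hX.isConnected hdense y) ?_
  have key : ∀ H K : Set Y, IsConnected H → closure H ∩ (X ∪ {y}) ⊆ H →
      closure K ∩ (X ∪ {y}) ⊆ K → H ∪ K = X ∪ {y} → y ∈ H → H = X ∪ {y} ∨ K = X ∪ {y} := by
    intro H K hH hHcl hKcl hHK hyH
    have hHX : H ⊆ X ∪ {y} := hHK ▸ subset_union_left
    by_cases hp : (H ∩ X).Nonempty
    · obtain ⟨p, hpH, hpX⟩ := hp
      exact Or.inl (hX.eq_union_singleton habs hdense hy hHX hH hHcl hyH hpH hpX)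
    · have hXK : X ⊆ K := fun z hz =>
        ((hHK ▸ Or.inl hz : z ∈ H ∪ K)).resolve_left fun hzH => hp ⟨z, hzH, hz⟩
      have hKX : K ⊆ X ∪ {y} := hHK ▸ subset_union_right
      exact Or.inr (hKX.antisymm fun z hz => hKcl ⟨hdense.mono hXK z, hz⟩)
  intro H K hH hK hHcl hKcl hHK
  rcases (hHK ▸ Or.inr rfl : y ∈ H ∪ K) with hyH | hyK
  · exact key H K hH hHcl hKcl hHK hyH
  · exact (key K H hK hKcl hHcl (by rwa [union_comm]) hyK).symm

/-- A nowhere dense `closure C` would be absorbed by `X`, yet it contains `y`. -/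
theorem IsIndecomposable.isSingularWrt (habs : AbsorbsNowhereDense X) (hdense : Dense X)
    (hX : IsIndecomposable X) {y : Y} (hy : y ∉ X) : IsSingularWrt X y := by
  refine ⟨hX.isConnected, fun C hCX hC hyC => inter_eq_right.2 ?_⟩
  rcases (interior (closure C)).eq_empty_or_nonempty with hint | hint
  · obtain ⟨c, hc⟩ := hC.nonempty
    exact absurd (habs _ isClosed_closure hC.closure hint ⟨c, subset_closure hc, hCX hc⟩ hyC)
      hy
  · exact hX.subset_closure_of_interior_nonempty hdense hCX hC hint

theorem IsIndecomposable.nonempty_compl_meagerComposant [CompactSpace Y] [T2Space Y]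
    [SecondCountableTopology Y] {x : Y} (hdense : Dense (meagerComposant x))
    (hX : IsIndecomposable (meagerComposant x)) : (meagerComposant x)ᶜ.Nonempty := by
  rw [nonempty_compl]
  intro huniv
  obtain ⟨p, hp⟩ := hX.isConnected.nonempty
  let 𝓑 := TopologicalSpace.countableBasis Y
  have : Countable 𝓑 := (TopologicalSpace.countable_countableBasis Y).to_subtype
  have hne : Nonempty Y := ⟨p⟩
  -- If `X` were all of `Y`, nowhere dense continua from `p` would show that these countably many
  -- sets cover `Y`. By Baire one has closure with interior, so it is dense in `X`, although it
  -- misses `U`.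
  let C : Set Y → Set Y := fun U => connectedComponentIn (meagerComposant x \ U) p
  have hcov : ⋃ U : 𝓑, closure (C U) = univ := by
    refine eq_univ_of_forall fun z => ?_
    obtain ⟨M, hMX, hMcl, hM, hMint, hpM, hzM⟩ :=
      exists_nowhereDense_continuum hp (huniv ▸ mem_univ z : z ∈ meagerComposant x)
    obtain ⟨w, hw⟩ : Mᶜ.Nonempty := by
      rw [nonempty_compl]
      rintro rfl
      simp at hMint
    obtain ⟨U, hU, hwU, hUM⟩ := (TopologicalSpace.isBasis_countableBasis Y).exists_subset_of_mem_open
      hw hMcl.isOpen_compl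
    refine mem_iUnion_of_mem (⟨U, hU⟩ : 𝓑) (subset_closure ?_)
    have hMU : M ⊆ meagerComposant x \ U := fun m hm => ⟨hMX hm, fun hmU => hUM hmU hm⟩
    exact hM.isPreconnected.subset_connectedComponentIn hpM hMU hzM
  obtain ⟨⟨U, hU⟩, hint⟩ := nonempty_interior_of_iUnion_of_closed
    (fun U : 𝓑 => isClosed_closure (s := C U)) hcov
  have hUopen := TopologicalSpace.isOpen_of_mem_countableBasis hU
  have hCsub : C U ⊆ meagerComposant x \ U := connectedComponentIn_subset _ _
  have hC : IsConnected (C U) :=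
    ⟨closure_nonempty_iff.1 (hint.mono interior_subset), isPreconnected_connectedComponentIn⟩
  have hsub := hX.subset_closure_of_interior_nonempty hdense (hCsub.trans sdiff_subset) hC hint
  obtain ⟨u, huU⟩ := TopologicalSpace.nonempty_of_mem_countableBasis hU
  obtain ⟨c, hcU, hcC⟩ := mem_closure_iff.1 (hsub (huniv ▸ mem_univ u)) U hUopen huU
  exact (hCsub hcC).2 hcU

theorem isIndecomposable_of_forall_mem_eq_union_singleton [T2Space Y] {x y p : Y}
    (hdense : Dense (meagerComposant x)) (hp : p ∈ meagerComposant x) (hy : y ∉ meagerComposant x)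
    (h : ∀ C ⊆ meagerComposant x ∪ {y}, IsConnected C →
      closure C ∩ (meagerComposant x ∪ {y}) ⊆ C → p ∈ C → y ∈ C → C = meagerComposant x ∪ {y}) :
    IsIndecomposable (meagerComposant x) := by
  refine isIndecomposable_of_forall_union_eq (isConnected_meagerComposant ⟨p, hp⟩) ?_
  have key : ∀ K ⊆ meagerComposant x, IsConnected K → closure K ∩ meagerComposant x ⊆ K →
      y ∈ closure K → K = meagerComposant x := by
    intro K hKX hK hKcl hyK
    obtain ⟨k, hk⟩ := hK.nonempty
    obtain ⟨M, hMX, hMcl, hM, hMint, hpM, hkM⟩ := exists_nowhereDense_continuum hp (hKX hk)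
    have hMK : IsConnected (M ∪ K) := hM.union ⟨k, hkM, hk⟩ hK
    -- The continuum `M` joins `p` to `K`, so irreducibility applies; as `M` is nowhere dense, `K`
    -- alone must be dense.
    have hC := h (M ∪ K ∪ {y}) (union_subset_union_left _ (union_subset hMX hKX))
      (hMK.subset_closure subset_union_left (union_subset subset_closure
        (singleton_subset_iff.2 (closure_mono subset_union_right hyK)))) (by
        rintro z ⟨hz, hzX⟩
        rcases hzX with hzX | hzy
        · rw [closure_union, closure_union, hMcl.closure_eq, closure_singleton] at hz
          exact hz.imp_left (Or.imp_right fun hzK => hKcl ⟨hzK, hzX⟩)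
        · exact Or.inr hzy) (Or.inl (Or.inl hpM)) (Or.inr rfl)
    have hsub : Mᶜ ∩ meagerComposant x ⊆ K := by
      rintro z ⟨hzM, hzX⟩
      rcases (hC.symm.subset (Or.inl hzX) : z ∈ M ∪ K ∪ {y}) with (h' | h') | rfl
      · exact absurd h' hzM
      · exact h'
      · exact absurd hzX hy
    have hKdense : Dense K :=
      ((interior_eq_empty_iff_dense_compl.1 hMint).inter_of_isOpen_left hdense
        hMcl.isOpen_compl).mono hsub
    exact hKX.antisymm fun z hz => hKcl ⟨hKdense z, hz⟩
  intro H K hH hK hHcl hKcl hHK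
  have hyHK : y ∈ closure (H ∪ K) := hHK ▸ hdense y
  rw [closure_union] at hyHK
  exact hyHK.imp (key H (hHK ▸ subset_union_left) hH hHcl)
    (key K (hHK ▸ subset_union_right) hK hKcl)

theorem isIndecomposable_of_isIrreducibleConnected_union_singleton [T2Space Y] {x y : Y}
    (hdense : Dense (meagerComposant x)) (hne : (meagerComposant x).Nonempty)
    (h : IsIrreducibleConnected ↥(meagerComposant x ∪ {y})) :
    IsIndecomposable (meagerComposant x) := by
  obtain ⟨-, p, hp, q, hq, h⟩ := isIrreducibleConnected_iff.1 h
  -- A nowhere dense continuum joining `p` and `q` inside `X` would have to be dense.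
  have hpq : ¬ (p ∈ meagerComposant x ∧ q ∈ meagerComposant x) := by
    rintro ⟨hp, hq⟩
    obtain ⟨M, hMX, hMcl, hM, hMint, hpM, hqM⟩ := exists_nowhereDense_continuum hp hq
    have hMeq := h M (hMX.trans subset_union_left) hM
      (by rw [hMcl.closure_eq]; exact inter_subset_left) hpM hqM
    have hMuniv : M = univ :=
      hMcl.closure_eq ▸ (hdense.mono (hMeq ▸ subset_union_left)).closure_eq
    rw [hMuniv, interior_univ] at hMint
    exact (hMint ▸ mem_univ p : p ∈ (∅ : Set Y))
  rcases hp with hp | rfl <;> rcases hq with hq | rfl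
  · exact absurd ⟨hp, hq⟩ hpq
  · exact isIndecomposable_of_forall_mem_eq_union_singleton hdense hp (fun hq => hpq ⟨hp, hq⟩) h
  · exact isIndecomposable_of_forall_mem_eq_union_singleton hdense hq (fun hp => hpq ⟨hp, hq⟩)
      fun C hCX hC hCcl hqC hpC => h C hCX hC hCcl hpC hqC
  -- Both points equal the added one, so the whole space is `{q}` and `q` lies in `X` after all.
  · have heq := h {q} subset_union_right isConnected_singleton
      (by rw [closure_singleton]; exact inter_subset_left) rfl rfl
    obtain ⟨z, hz⟩ := hne
    have hzq : z = q := heq.symm.subset (Or.inl hz)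
    exact absurd ⟨hzq ▸ hz, hzq ▸ hz⟩ hpq

end DenseMeagerComposant

end ContinuumTheory

theorem proposition2p4 {Y : Type*} [TopologicalSpace Y] [CompactSpace Y] [ConnectedSpace Y]
    [TopologicalSpace.MetrizableSpace Y] [Nontrivial Y]
    (X : Set Y) (hX : ∃ x : Y, X = ContinuumTheory.meagerComposant x) (hdense : Dense X) :
    List.TFAE [
      ContinuumTheory.IsIndecomposable X,
      ContinuumTheory.IsStronglyIndecomposable X,
      ∃ y : Y, ContinuumTheory.IsSingularWrt X y,
      Xᶜ.Nonempty ∧ ∀ y ∈ Xᶜ, ContinuumTheory.IsSingularWrt X y,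
      ∃ y : Y, ContinuumTheory.IsIrreducibleConnected ↥(X ∪ {y}),
      Xᶜ.Nonempty ∧ ∀ y ∈ Xᶜ, ContinuumTheory.IsIrreducibleConnected ↥(X ∪ {y}),
      ∀ y : Y, ContinuumTheory.IsIndecomposable ↥(X ∪ {y})] := by
  obtain ⟨x, rfl⟩ := hX
  have hsc : SecondCountableTopology Y := by
    let _ := TopologicalSpace.metrizableSpaceMetric Y
    infer_instance
  have hne : (ContinuumTheory.meagerComposant x).Nonempty := hdense.nonempty
  have habs := ContinuumTheory.absorbsNowhereDense_meagerComposant x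
  tfae_have 1 → 2 := fun h => h.isStronglyIndecomposable habs
  tfae_have 2 → 1 := fun h => h.isIndecomposable
  tfae_have 1 → 4 := fun h =>
    ⟨h.nonempty_compl_meagerComposant hdense, fun y hy => h.isSingularWrt habs hdense hy⟩
  tfae_have 4 → 3 := fun ⟨⟨y, hy⟩, h⟩ => ⟨y, h y hy⟩
  tfae_have 3 → 1 := fun ⟨y, h⟩ => h.isIndecomposable hdense
  tfae_have 1 → 6 := fun h => ⟨h.nonempty_compl_meagerComposant hdense,
    fun y hy => h.isIrreducibleConnected_union_singleton habs hdense hy⟩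
  tfae_have 6 → 5 := fun ⟨⟨y, hy⟩, h⟩ => ⟨y, h y hy⟩
  tfae_have 5 → 1 := fun ⟨y, h⟩ =>
    ContinuumTheory.isIndecomposable_of_isIrreducibleConnected_union_singleton hdense hne h
  tfae_have 1 → 7 := fun h y => h.union_singleton habs hdense y
  tfae_have 7 → 1 := fun h => by
    obtain ⟨y, hy⟩ := hne
    have := h y
    rwa [Set.union_eq_left.2 (Set.singleton_subset_iff.2 hy)] at this
  tfae_finish
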